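/- Rings and modules are associative but not assumed unital. For a ring $R$, let $\widetilde R=\mathbb Z\oplus R$ be the unital ring obtained by formally adjoining a unit to $R$. A (nonunital) left or right $R$-module is the same thing as a unital left or right $\widetilde R$-module. For a right $R$-module $N$ and a left $R$-module $M$, the abelian group $N\otimes_R M$ is the quotient of $N\otimes_{\mathbb Z}M$ by the subgroup generated by the elements $xr\otimes y-x\otimes ry$ with $x\in N$, $r\in R$, $y\in M$. A left $R$-module $M$ is *t-unital* if the natural map $R\otimes_R M\to M$, $r\otimes x\mapsto rx$, is an isomorphism; a right $R$-module $N$ is *t-unital* if the natural map $N\otimes_R R\to N$, $x\otimes r\mapsto xr$, is an isomorphism. The ring $R$ is *t-unital* if the map $R\otimes_R R\to R$, $r\otimes s\mapsto rs$, is an isomorphism. Left (respectively, right) t-unital modules form a full subcategory of the category of all nonunital left (respectively, right) $R$-modules. Let $R$ be a t-unital ring. A left $R$-module $F$ is *t-flat* if the functor $-\otimes_R F$ from the category of t-unital right $R$-modules to the category of abelian groups preserves kernels: whenever $K\to L$ is a kernel of a morphism $L\to M$ in the category of t-unital right $R$-modules, the map $K\otimes_R F\to L\otimes_R F$ is a kernel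 of $L\otimes_R F\to M\otimes_R F$ in the category of abelian groups. A t-flat right $R$-module is defined similarly, with the functor $F\otimes_R-$ on the category of t-unital left $R$-modules. **Corollary.** Let $R$ be a t-unital ring and let $F$ be a t-unital (left or right) $R$-module. Then $F$ is t-flat if and only if $F$ is a flat nonunital $R$-module, that is, if and only if $F$ is a flat unital $\widetilde R$-module. -/

import Mathlib

open MulOpposite TensorProduct

universe u v w

namespace NonunitalTensor

/-- A (nonunital) left module over an associative, not necessarily unital ring: an abelian group
with a biadditive, associative action. Right `R`-modules are modules over `Rᵐᵒᵖ`, the element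
`x r` being written `op r • x`, as everywhere in Mathlib. -/
class NonunitalModule (R : Type u) [NonUnitalRing R] (M : Type v) [AddCommGroup M] extends
    SMul R M where
  protected smul_add : ∀ (r : R) (x y : M), r • (x + y) = r • x + r • y
  protected add_smul : ∀ (r s : R) (x : M), (r + s) • x = r • x + s • x
  protected mul_smul : ∀ (r s : R) (x : M), (r * s) • x = r • (s • x)

/-- The ring `R` as a left `R`-module. -/
instance instSelf (R : Type u) [NonUnitalRing R] : NonunitalModule R R where
  smul_add := fun r x y => mul_add r x y
  add_smul := fun r s x => add_mul r s x
  mul_smul := fun r s x => mul_assoc r s x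

/-- The ring `R` as a right `R`-module. -/
instance instSelfRight (R : Type u) [NonUnitalRing R] : NonunitalModule Rᵐᵒᵖ R where
  smul_add := fun r x y => add_mul x y r.unop
  add_smul := fun r s x => mul_add x r.unop s.unop
  mul_smul := fun r s x => (mul_assoc x s.unop r.unop).symm

section Basic

variable {R : Type u} [NonUnitalRing R] {M : Type v} [AddCommGroup M] [NonunitalModule R M]

theorem smul_zero' (r : R) : r • (0 : M) = 0 := by
  have h := NonunitalModule.smul_add r (0 : M) 0
  rw [add_zero] at h
  exact left_eq_add.mp h

theorem zero_smul' (x : M) : (0 : R) • x = 0 := by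
  have h := NonunitalModule.add_smul (0 : R) 0 x
  rw [add_zero] at h
  exact left_eq_add.mp h

/-- The action as a biadditive map. -/
def smulHom (R : Type u) [NonUnitalRing R] (M : Type v) [AddCommGroup M]
    [NonunitalModule R M] : R →+ M →+ M :=
  AddMonoidHom.mk' (fun r => AddMonoidHom.mk' (fun x => r • x) (NonunitalModule.smul_add r))
    (fun r s => AddMonoidHom.ext fun x => NonunitalModule.add_smul r s x)

theorem smulHom_apply (r : R) (x : M) : smulHom R M r x = r • x := rfl

theorem zsmul_smul' (n : ℤ) (r : R) (x : M) : (n • r) • x = n • (r • x) := by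
  rw [← smulHom_apply, ← smulHom_apply, map_zsmul]; rfl

theorem smul_zsmul' (n : ℤ) (r : R) (x : M) : r • (n • x) = n • (r • x) := by
  rw [← smulHom_apply, ← smulHom_apply, map_zsmul]

end Basic

/-- Homomorphisms of nonunital modules. -/
structure Hom (R : Type u) [NonUnitalRing R] (M : Type v) [AddCommGroup M] [NonunitalModule R M]
    (M' : Type w) [AddCommGroup M'] [NonunitalModule R M'] extends M →+ M' where
  map_smul' : ∀ (r : R) (x : M), toFun (r • x) = r • toFun x

theorem Hom.map_smul {R : Type u} [NonUnitalRing R] {M : Type v} [AddCommGroup M]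
    [NonunitalModule R M] {M' : Type w} [AddCommGroup M'] [NonunitalModule R M'] (f : Hom R M M')
    (r : R) (x : M) : f.toAddMonoidHom (r • x) = r • f.toAddMonoidHom x :=
  f.map_smul' r x

theorem linear_map_smul {A : Type u} [Ring A] {M : Type v} [AddCommGroup M] [Module A M]
    {M' : Type w} [AddCommGroup M'] [Module A M'] (f : M →ₗ[A] M') (a : A) (x : M) :
    f.toAddMonoidHom (a • x) = a • f.toAddMonoidHom x :=
  f.map_smul a x

/-! ### The tensor product of a right module and a left module -/

section Tensor

/-- The subgroup of `N ⊗_ℤ M` generated by the elements `x r ⊗ y - x ⊗ r y`. -/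
def balancedRel (R : Type u) (N : Type v) (M : Type w) [AddCommGroup N] [AddCommGroup M]
    [SMul Rᵐᵒᵖ N] [SMul R M] : AddSubgroup (N ⊗[ℤ] M) :=
  AddSubgroup.closure {t | ∃ (x : N) (r : R) (y : M), t = (op r • x) ⊗ₜ[ℤ] y - x ⊗ₜ[ℤ] (r • y)}

/-- The abelian group `N ⊗_R M`, for a right `R`-module `N` and a left `R`-module `M`. The ring `R`
need neither be commutative nor unital; the same construction is used for unital modules over
unital rings. -/
abbrev BTensor (R : Type u) (N : Type v) (M : Type w) [AddCommGroup N] [AddCommGroup M]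
    [SMul Rᵐᵒᵖ N] [SMul R M] : Type (max v w) :=
  (N ⊗[ℤ] M) ⧸ balancedRel R N M

variable {R : Type*} {N N' M M' G : Type*} [AddCommGroup N] [AddCommGroup N'] [AddCommGroup M]
  [AddCommGroup M'] [AddCommGroup G] [SMul Rᵐᵒᵖ N] [SMul Rᵐᵒᵖ N'] [SMul R M] [SMul R M']

/-- The class of `x ⊗ y` in `N ⊗_R M`. -/
def BTensor.tmul (R : Type*) {N M : Type*} [AddCommGroup N] [AddCommGroup M]
    [SMul Rᵐᵒᵖ N] [SMul R M] (x : N) (y : M) : BTensor R N M :=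
  QuotientAddGroup.mk (x ⊗ₜ[ℤ] y)

theorem BTensor.smul_tmul (x : N) (r : R) (y : M) :
    BTensor.tmul R (op r • x) y = BTensor.tmul R x (r • y) := by
  refine (QuotientAddGroup.eq_iff_sub_mem).2 ?_
  exact AddSubgroup.subset_closure ⟨x, r, y, rfl⟩

/-- The homomorphism `N ⊗_R M → G` induced by an `R`-balanced biadditive map. -/
def BTensor.lift (b : N →+ M →+ G)
    (hb : ∀ (x : N) (r : R) (y : M), b (op r • x) y = b x (r • y)) : BTensor R N M →+ G :=
  QuotientAddGroup.lift (balancedRel R N M)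
    (TensorProduct.liftAddHom b fun n x y => by simp)
    (by
      refine (AddSubgroup.closure_le _).2 ?_
      rintro _ ⟨x, r, y, rfl⟩
      simp [AddMonoidHom.mem_ker, hb])

@[simp] theorem BTensor.lift_tmul (b : N →+ M →+ G)
    (hb : ∀ (x : N) (r : R) (y : M), b (op r • x) y = b x (r • y)) (x : N) (y : M) :
    BTensor.lift b hb (BTensor.tmul R x y) = b x y := rfl

/-- `tmul` as a biadditive map. -/
def BTensor.tmulHom (R : Type*) (N M : Type*) [AddCommGroup N] [AddCommGroup M]
    [SMul Rᵐᵒᵖ N] [SMul R M] : N →+ M →+ BTensor R N M :=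
  AddMonoidHom.mk' (fun x => AddMonoidHom.mk' (fun y => BTensor.tmul R x y) fun y y' => by
      simp [BTensor.tmul, TensorProduct.tmul_add])
    (fun x x' => by
      ext y
      simp [BTensor.tmul, TensorProduct.add_tmul])

/-- The map `f ⊗ M : N ⊗_R M → N' ⊗_R M` induced by a homomorphism of right modules. -/
def BTensor.mapLeft (M : Type*) [AddCommGroup M] [SMul R M] (f : N →+ N')
    (hf : ∀ (r : Rᵐᵒᵖ) (x : N), f (r • x) = r • f x) : BTensor R N M →+ BTensor R N' M :=
  BTensor.lift ((BTensor.tmulHom R N' M).comp f) fun x r y => by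
    change BTensor.tmul R (f (op r • x)) y = BTensor.tmul R (f x) (r • y)
    rw [hf, BTensor.smul_tmul]

/-- The map `N ⊗ f : N ⊗_R M → N ⊗_R M'` induced by a homomorphism of left modules. -/
def BTensor.mapRight (N : Type*) [AddCommGroup N] [SMul Rᵐᵒᵖ N] (f : M →+ M')
    (hf : ∀ (r : R) (y : M), f (r • y) = r • f y) : BTensor R N M →+ BTensor R N M' :=
  BTensor.lift ((AddMonoidHom.compHom' f).comp (BTensor.tmulHom R N M')) fun x r y => by
    change BTensor.tmul R (op r • x) (f y) = BTensor.tmul R x (f (r • y))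
    rw [hf, BTensor.smul_tmul]

@[simp] theorem BTensor.mapLeft_tmul (f : N →+ N')
    (hf : ∀ (r : Rᵐᵒᵖ) (x : N), f (r • x) = r • f x) (x : N) (y : M) :
    BTensor.mapLeft M f hf (BTensor.tmul R x y) = BTensor.tmul R (f x) y := rfl

@[simp] theorem BTensor.mapRight_tmul (f : M →+ M')
    (hf : ∀ (r : R) (y : M), f (r • y) = r • f y) (x : N) (y : M) :
    BTensor.mapRight N f hf (BTensor.tmul R x y) = BTensor.tmul R x (f y) := rfl

end Tensor

/-! ### t-unital modules and rings -/

section TUnital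

variable (R : Type u) [NonUnitalRing R]

/-- The natural map `R ⊗_R M → M`, `r ⊗ x ↦ r x`. -/
def leftUnitMap (M : Type v) [AddCommGroup M] [NonunitalModule R M] : BTensor R R M →+ M :=
  BTensor.lift (smulHom R M) fun s r x => NonunitalModule.mul_smul s r x

/-- The natural map `N ⊗_R R → N`, `x ⊗ r ↦ x r`. -/
def rightUnitMap (N : Type v) [AddCommGroup N] [NonunitalModule Rᵐᵒᵖ N] : BTensor R N R →+ N :=
  BTensor.lift ((smulHom Rᵐᵒᵖ N).comp (opAddEquiv : R ≃+ Rᵐᵒᵖ).toAddMonoidHom).flip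
    fun x r s => (NonunitalModule.mul_smul (op s) (op r) x).symm

/-- A left module `M` is t-unital if `R ⊗_R M → M` is an isomorphism. -/
def TUnitalLeft (M : Type v) [AddCommGroup M] [NonunitalModule R M] : Prop :=
  Function.Bijective (leftUnitMap R M)

/-- A right module `N` is t-unital if `N ⊗_R R → N` is an isomorphism. -/
def TUnitalRight (N : Type v) [AddCommGroup N] [NonunitalModule Rᵐᵒᵖ N] : Prop :=
  Function.Bijective (rightUnitMap R N)

/-- The ring `R` is t-unital if `R ⊗_R R → R`, `r ⊗ s ↦ r s`, is an isomorphism. -/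
def TUnitalRing : Prop := Function.Bijective (leftUnitMap R R)

end TUnital

/-! ### Kernels of morphisms of t-unital modules, and t-flatness -/

/-- For `S`-modules, `i : K → L` is a kernel of `f : L → M` in the full subcategory of the modules
(in the universe `w`) that satisfy `P`: the universal property, for objects of that subcategory. -/
def IsKernelIn {S : Type u} [NonUnitalRing S]
    (P : ∀ (X : Type w) [AddCommGroup X] [NonunitalModule S X], Prop)
    {K L M : Type w} [AddCommGroup K] [NonunitalModule S K] [AddCommGroup L] [NonunitalModule S L]
    [AddCommGroup M] [NonunitalModule S M] (i : Hom S K L) (f : Hom S L M) : Prop :=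
  P K ∧ P L ∧ P M ∧ f.toAddMonoidHom.comp i.toAddMonoidHom = 0 ∧
    ∀ (X : Type w) [AddCommGroup X] [NonunitalModule S X], P X → ∀ g : Hom S X L,
      f.toAddMonoidHom.comp g.toAddMonoidHom = 0 →
        ∃! h : Hom S X K, i.toAddMonoidHom.comp h.toAddMonoidHom = g.toAddMonoidHom

/-- A left `R`-module `F` is t-flat if `- ⊗_R F` takes kernels in the category of t-unital right
`R`-modules to kernels of abelian groups. The universe of the test modules contains (copies of)
both `R` and `F`. -/
def TFlatLeft (R : Type u) [NonUnitalRing R] (F : Type v) [AddCommGroup F]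
    [NonunitalModule R F] : Prop :=
  ∀ (K L M : Type (max u v)) [AddCommGroup K] [NonunitalModule Rᵐᵒᵖ K] [AddCommGroup L]
    [NonunitalModule Rᵐᵒᵖ L] [AddCommGroup M] [NonunitalModule Rᵐᵒᵖ M]
    (i : Hom Rᵐᵒᵖ K L) (f : Hom Rᵐᵒᵖ L M),
    IsKernelIn (fun X _ _ => TUnitalRight R X) i f →
      Function.Injective (BTensor.mapLeft (R := R) F i.toAddMonoidHom i.map_smul) ∧
      Function.Exact (BTensor.mapLeft (R := R) F i.toAddMonoidHom i.map_smul)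
        (BTensor.mapLeft (R := R) F f.toAddMonoidHom f.map_smul)

/-- A right `R`-module `F` is t-flat if `F ⊗_R -` takes kernels in the category of t-unital left
`R`-modules to kernels of abelian groups. -/
def TFlatRight (R : Type u) [NonUnitalRing R] (F : Type v) [AddCommGroup F]
    [NonunitalModule Rᵐᵒᵖ F] : Prop :=
  ∀ (K L M : Type (max u v)) [AddCommGroup K] [NonunitalModule R K] [AddCommGroup L]
    [NonunitalModule R L] [AddCommGroup M] [NonunitalModule R M]
    (i : Hom R K L) (f : Hom R L M),
    IsKernelIn (fun X _ _ => TUnitalLeft R X) i f →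
      Function.Injective (BTensor.mapRight (R := R) F i.toAddMonoidHom i.map_smul) ∧
      Function.Exact (BTensor.mapRight (R := R) F i.toAddMonoidHom i.map_smul)
        (BTensor.mapRight (R := R) F f.toAddMonoidHom f.map_smul)

/-! ### Flatness over a unital ring, and over the unitalization `ℤ ⊕ R` -/

/-- A unital left module `F` over a (noncommutative) unital ring `A` is flat if `- ⊗_A F` preserves
injectivity of morphisms of unital right `A`-modules. -/
def FlatLeft (A : Type u) [Ring A] (F : Type v) [AddCommGroup F] [Module A F] : Prop :=
  ∀ (N N' : Type (max u v)) [AddCommGroup N] [Module Aᵐᵒᵖ N] [AddCommGroup N'] [Module Aᵐᵒᵖ N']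
    (f : N →ₗ[Aᵐᵒᵖ] N'), Function.Injective f →
      Function.Injective (BTensor.mapLeft (R := A) F f.toAddMonoidHom (linear_map_smul f))

/-- A unital right module `F` over a (noncommutative) unital ring `A` is flat if `F ⊗_A -` preserves
injectivity of morphisms of unital left `A`-modules. -/
def FlatRight (A : Type u) [Ring A] (F : Type v) [AddCommGroup F] [Module Aᵐᵒᵖ F] : Prop :=
  ∀ (N N' : Type (max u v)) [AddCommGroup N] [Module A N] [AddCommGroup N'] [Module A N']
    (f : N →ₗ[A] N'), Function.Injective f →
      Function.Injective (BTensor.mapRight (R := A) F f.toAddMonoidHom (linear_map_smul f))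

/-- A nonunital left `R`-module as a unital left module over the ring `ℤ ⊕ R`:
`(n + r) x = n x + r x`. -/
abbrev unitizationModule (R : Type u) [NonUnitalRing R] (M : Type v) [AddCommGroup M]
    [NonunitalModule R M] : Module (Unitization ℤ R) M where
  smul a x := a.fst • x + a.snd • x
  one_smul x := by
    change (1 : Unitization ℤ R).fst • x + (1 : Unitization ℤ R).snd • x = x
    simp [zero_smul']
  mul_smul a b x := by
    change (a * b).fst • x + (a * b).snd • x
      = a.fst • (b.fst • x + b.snd • x) + a.snd • (b.fst • x + b.snd • x)
    simp only [Unitization.fst_mul, Unitization.snd_mul, NonunitalModule.add_smul,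
      NonunitalModule.smul_add, NonunitalModule.mul_smul, zsmul_smul', smul_zsmul', smul_add,
      mul_smul]
    abel
  smul_zero a := by
    change a.fst • (0 : M) + a.snd • (0 : M) = 0
    simp [smul_zero']
  zero_smul x := by
    change (0 : Unitization ℤ R).fst • x + (0 : Unitization ℤ R).snd • x = 0
    simp [zero_smul']
  smul_add a x y := by
    change a.fst • (x + y) + a.snd • (x + y) = (a.fst • x + a.snd • x) + (a.fst • y + a.snd • y)
    rw [NonunitalModule.smul_add, smul_add]
    abel
  add_smul a b x := by
    change (a + b).fst • x + (a + b).snd • x = (a.fst • x + a.snd • x) + (b.fst • x + b.snd • x)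
    rw [Unitization.fst_add, Unitization.snd_add, NonunitalModule.add_smul, add_smul]
    abel

/-- A nonunital right `R`-module as a unital right module over the ring `ℤ ⊕ R`:
`x (n + r) = n x + x r`. -/
abbrev unitizationModuleRight (R : Type u) [NonUnitalRing R] (M : Type v) [AddCommGroup M]
    [NonunitalModule Rᵐᵒᵖ M] : Module (Unitization ℤ R)ᵐᵒᵖ M where
  smul a x := a.unop.fst • x + op a.unop.snd • x
  one_smul x := by
    change (1 : Unitization ℤ R).fst • x + op (1 : Unitization ℤ R).snd • x = x
    simp [zero_smul']
  mul_smul a b x := by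
    change (b.unop * a.unop).fst • x + op (b.unop * a.unop).snd • x
      = a.unop.fst • (b.unop.fst • x + op b.unop.snd • x)
        + op a.unop.snd • (b.unop.fst • x + op b.unop.snd • x)
    simp only [Unitization.fst_mul, Unitization.snd_mul, op_add, op_mul, op_smul,
      NonunitalModule.add_smul, NonunitalModule.smul_add, NonunitalModule.mul_smul, zsmul_smul',
      smul_zsmul', smul_add]
    rw [mul_comm, mul_smul]
    abel
  smul_zero a := by
    change a.unop.fst • (0 : M) + op a.unop.snd • (0 : M) = 0
    simp [smul_zero']
  zero_smul x := by
    change (0 : Unitization ℤ R).fst • x + op (0 : Unitization ℤ R).snd • x = 0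
    simp [zero_smul']
  smul_add a x y := by
    change a.unop.fst • (x + y) + op a.unop.snd • (x + y)
      = (a.unop.fst • x + op a.unop.snd • x) + (a.unop.fst • y + op a.unop.snd • y)
    rw [NonunitalModule.smul_add, smul_add]
    abel
  add_smul a b x := by
    change (a.unop + b.unop).fst • x + op (a.unop + b.unop).snd • x
      = (a.unop.fst • x + op a.unop.snd • x) + (b.unop.fst • x + op b.unop.snd • x)
    rw [Unitization.fst_add, Unitization.snd_add, op_add, NonunitalModule.add_smul, add_smul]
    abel

/-- A nonunital left `R`-module is flat if it is flat as a unital left module over `ℤ ⊕ R`. -/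
def FlatNonunitalLeft (R : Type u) [NonUnitalRing R] (F : Type v) [AddCommGroup F]
    [NonunitalModule R F] : Prop :=
  letI := unitizationModule R F
  FlatLeft (Unitization ℤ R) F

/-- A nonunital right `R`-module is flat if it is flat as a unital right module over `ℤ ⊕ R`. -/
def FlatNonunitalRight (R : Type u) [NonUnitalRing R] (F : Type v) [AddCommGroup F]
    [NonunitalModule Rᵐᵒᵖ F] : Prop :=
  letI := unitizationModuleRight R F
  FlatRight (Unitization ℤ R) F

end NonunitalTensor

/-! Flatness over `ℤ ⊕ R` says that `- ⊗_R F` preserves injections of nonunital right `R`-modules,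
because balancing over integers is automatic (`flatNonunitalLeft_iff`). t-flatness concerns kernels
in the subcategory of t-unital modules, which can differ from set-theoretic kernels. The discrepancy
is annihilated by `R`, and a t-unital `F` cannot see it: `F` is generated by products `r y`, and `x
⊗ r y = x r ⊗ y`.

The bridge between the two settings is `N ⊗_R R`. It is t-unital for every `N` because `R` is
(`TUnitalRing.tUnitalRight_tensor`), and for t-unital `F` the map `(N ⊗_R R) ⊗_R F → N ⊗_R F` is an
isomorphism (`TUnitalLeft.bijective_mapLeft_rightUnitHom`).

Flat implies t-flat: let `i` be a kernel of `f` among t-unital modules. Testing the universal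
property on `(ker i) ⊗_R R` and `(ker f) ⊗_R R` shows that `R` kills `ker i` and that `(ker f) R`
lies in the image of `i`. By flatness the kernels of `i ⊗ F` and `f ⊗ F` are generated by tensors `x
⊗ y` with `x` in `ker i`, respectively `ker f`. Moving a factor `r` from `y` to `x` makes the former
vanish and puts the latter in the image of `i ⊗ F`.

t-flat implies flat: for injective `f : N → N'`, the map `f ⊗ R` has zero kernel among t-unital
modules, even where it is not injective (`isKernelIn_zero_rTensor`). So `(f ⊗ R) ⊗ F` is injective,
and by the bridge it is isomorphic to `f ⊗ F`.

For right modules the two tensor factors are exchanged throughout. -/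

namespace NonunitalTensor

/-! ### Generators and right exactness of the tensor product. -/

section TensorLemmas

theorem BTensor.induction {R N M : Type*} [AddCommGroup N] [AddCommGroup M] [SMul Rᵐᵒᵖ N]
    [SMul R M] {P : BTensor R N M → Prop} (tmul : ∀ x y, P (BTensor.tmul R x y))
    (add : ∀ z w, P z → P w → P (z + w)) (z : BTensor R N M) : P z := by
  induction z using QuotientAddGroup.induction_on with
  | H z =>
    induction z using TensorProduct.induction_on with
    | zero =>
      -- No separate zero case is required, since `0 = 0 ⊗ 0` is itself a pure tensor.
      have h := tmul 0 0
      rwa [BTensor.tmul, TensorProduct.zero_tmul] at h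
    | tmul x y => exact tmul x y
    | add z w hz hw => exact add _ _ hz hw

theorem BTensor.hom_ext {R N M G : Type*} [AddCommGroup N] [AddCommGroup M] [SMul Rᵐᵒᵖ N]
    [SMul R M] [AddCommGroup G] {f g : BTensor R N M →+ G}
    (h : ∀ x y, f (BTensor.tmul R x y) = g (BTensor.tmul R x y)) : f = g := by
  refine AddMonoidHom.ext fun z => ?_
  induction z using BTensor.induction with
  | tmul x y => exact h x y
  | add z w hz hw => rw [map_add, map_add, hz, hw]

variable {R N M : Type*} [AddCommGroup N] [AddCommGroup M] [SMul Rᵐᵒᵖ N] [SMul R M]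

theorem BTensor.tmul_add (x : N) (y y' : M) :
    BTensor.tmul R x (y + y') = BTensor.tmul R x y + BTensor.tmul R x y' :=
  (BTensor.tmulHom R N M x).map_add y y'

theorem BTensor.add_tmul (x x' : N) (y : M) :
    BTensor.tmul R (x + x') y = BTensor.tmul R x y + BTensor.tmul R x' y :=
  DFunLike.congr_fun ((BTensor.tmulHom R N M).map_add x x') y

theorem BTensor.tmul_zero (x : N) : BTensor.tmul R x (0 : M) = 0 :=
  (BTensor.tmulHom R N M x).map_zero

theorem BTensor.zero_tmul (y : M) : BTensor.tmul R (0 : N) y = 0 :=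
  DFunLike.congr_fun (BTensor.tmulHom R N M).map_zero y

/-- Right exactness of `- ⊗_R M`. -/
theorem BTensor.mem_closure_of_mapLeft_eq_zero {N' : Type*} [AddCommGroup N'] [SMul Rᵐᵒᵖ N']
    (f : N →+ N') (hf : ∀ (r : Rᵐᵒᵖ) (x : N), f (r • x) = r • f x)
    (hsurj : Function.Surjective f) {z : BTensor R N M} (hz : BTensor.mapLeft M f hf z = 0) :
    z ∈ AddSubgroup.closure {t | ∃ x y, f x = 0 ∧ t = BTensor.tmul R x y} := by
  set I := AddSubgroup.closure {t : BTensor R N M | ∃ x y, f x = 0 ∧ t = BTensor.tmul R x y}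
  have hsec : Function.RightInverse (Function.surjInv hsurj) f := Function.surjInv_eq hsurj
  -- Modulo `I` the tensor `x ⊗ y` depends only on `f x`, so it descends to a balanced map on `N' ×
  -- M`. The induced `s` satisfies `s ∘ (f ⊗ M) = mk`, which forces the kernel of `f ⊗ M` into `I`.
  let b₀ : N →+ M →+ BTensor R N M ⧸ I :=
    (AddMonoidHom.compHom (QuotientAddGroup.mk' I)).comp (BTensor.tmulHom R N M)
  let b : N' →+ M →+ BTensor R N M ⧸ I :=
    AddMonoidHom.liftOfRightInverse f _ hsec ⟨b₀, fun x hx => AddMonoidHom.ext fun y =>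
      (QuotientAddGroup.eq_zero_iff _).2 (AddSubgroup.subset_closure ⟨x, y, hx, rfl⟩)⟩
  have hb : ∀ x, b (f x) = b₀ x := fun x =>
    AddMonoidHom.liftOfRightInverse_comp_apply f _ hsec _ x
  let s : BTensor R N' M →+ BTensor R N M ⧸ I := BTensor.lift b fun x r y => by
    obtain ⟨x, rfl⟩ := hsurj x
    rw [← hf, hb, hb]
    exact congrArg (QuotientAddGroup.mk' I) (BTensor.smul_tmul x r y)
  have hs : s.comp (BTensor.mapLeft M f hf) = QuotientAddGroup.mk' I :=
    BTensor.hom_ext fun x y => DFunLike.congr_fun (hb x) y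
  rw [← QuotientAddGroup.eq_zero_iff]
  change QuotientAddGroup.mk' I z = 0
  rw [← hs, AddMonoidHom.comp_apply, hz, map_zero]

/-- Right exactness of `N ⊗_R -`. -/
theorem BTensor.mem_closure_of_mapRight_eq_zero {M' : Type*} [AddCommGroup M'] [SMul R M']
    (f : M →+ M') (hf : ∀ (r : R) (y : M), f (r • y) = r • f y)
    (hsurj : Function.Surjective f) {z : BTensor R N M} (hz : BTensor.mapRight N f hf z = 0) :
    z ∈ AddSubgroup.closure {t | ∃ x y, f y = 0 ∧ t = BTensor.tmul R x y} := by
  set I := AddSubgroup.closure {t : BTensor R N M | ∃ x y, f y = 0 ∧ t = BTensor.tmul R x y}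
  have hsec : Function.RightInverse (Function.surjInv hsurj) f := Function.surjInv_eq hsurj
  let b₀ : M →+ N →+ BTensor R N M ⧸ I :=
    ((AddMonoidHom.compHom (QuotientAddGroup.mk' I)).comp (BTensor.tmulHom R N M)).flip
  let b : M' →+ N →+ BTensor R N M ⧸ I :=
    AddMonoidHom.liftOfRightInverse f _ hsec ⟨b₀, fun y hy => AddMonoidHom.ext fun x =>
      (QuotientAddGroup.eq_zero_iff _).2 (AddSubgroup.subset_closure ⟨x, y, hy, rfl⟩)⟩
  have hb : ∀ x, b (f x) = b₀ x := fun x =>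
    AddMonoidHom.liftOfRightInverse_comp_apply f _ hsec _ x
  let s : BTensor R N M' →+ BTensor R N M ⧸ I := BTensor.lift b.flip fun x r y => by
    obtain ⟨y, rfl⟩ := hsurj y
    rw [← hf, AddMonoidHom.flip_apply, AddMonoidHom.flip_apply, hb, hb]
    exact congrArg (QuotientAddGroup.mk' I) (BTensor.smul_tmul x r y)
  have hs : s.comp (BTensor.mapRight N f hf) = QuotientAddGroup.mk' I :=
    BTensor.hom_ext fun x y => DFunLike.congr_fun (hb y) x
  rw [← QuotientAddGroup.eq_zero_iff]
  change QuotientAddGroup.mk' I z = 0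
  rw [← hs, AddMonoidHom.comp_apply, hz, map_zero]

end TensorLemmas

/-! ### Constructions with nonunital modules -/

section Modules

variable {R : Type u} [NonUnitalRing R] {M : Type v} [AddCommGroup M] [NonunitalModule R M]
  {M' : Type w} [AddCommGroup M'] [NonunitalModule R M']

/-- A subgroup stable under the action is a nonunital module. -/
abbrev NonunitalModule.ofAddSubgroup (S : AddSubgroup M) (hS : ∀ (r : R), ∀ x ∈ S, r • x ∈ S) :
    NonunitalModule R S where
  smul r x := ⟨r • (x : M), hS r x x.2⟩
  smul_add r x y := Subtype.ext (NonunitalModule.smul_add r (x : M) y)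
  add_smul r s x := Subtype.ext (NonunitalModule.add_smul r s (x : M))
  mul_smul r s x := Subtype.ext (NonunitalModule.mul_smul r s (x : M))

/-- The kernel of a homomorphism as a nonunital module. -/
instance Hom.kerModule (f : Hom R M M') : NonunitalModule R f.toAddMonoidHom.ker :=
  NonunitalModule.ofAddSubgroup _ fun r x hx => by
    rw [AddMonoidHom.mem_ker] at hx ⊢
    rw [f.map_smul, hx, smul_zero']

/-- The range of a homomorphism as a nonunital module. -/
instance Hom.rangeModule (f : Hom R M M') : NonunitalModule R f.toAddMonoidHom.range :=
  NonunitalModule.ofAddSubgroup _ fun r x hx => by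
    obtain ⟨y, rfl⟩ := hx
    exact ⟨r • y, f.map_smul r y⟩

/-- The zero module. -/
instance punitModule : NonunitalModule R PUnit where
  smul _ x := x
  smul_add _ _ _ := rfl
  add_smul _ _ _ := rfl
  mul_smul _ _ _ := rfl

/-- The zero homomorphism. -/
def Hom.zero (R : Type u) [NonUnitalRing R] (M : Type v) [AddCommGroup M] [NonunitalModule R M]
    (M' : Type w) [AddCommGroup M'] [NonunitalModule R M'] : Hom R M M' :=
  { (0 : M →+ M') with map_smul' := fun r _ => (smul_zero' r).symm }

theorem Hom.ext_toAddMonoidHom {f g : Hom R M M'} (h : f.toAddMonoidHom = g.toAddMonoidHom) :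
    f = g := by
  cases f; cases g; congr

end Modules

/-! ### The modules `N ⊗_R R` and `R ⊗_R M`, and generation of t-unital modules by products. -/

section TensorModules

variable {R : Type u} [NonUnitalRing R]

/-- The right module `N ⊗_R R`. -/
instance tensorModuleRight (N : Type v) [AddCommGroup N] [NonunitalModule Rᵐᵒᵖ N] :
    NonunitalModule Rᵐᵒᵖ (BTensor R N R) where
  smul s z := BTensor.mapRight (R := R) N (AddMonoidHom.mulRight s.unop)
    (fun r y => mul_assoc r y s.unop) z
  smul_add s z w := map_add _ z w
  add_smul s t z := by
    induction z using BTensor.induction with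
    | tmul x y => exact (congrArg _ (mul_add y s.unop t.unop)).trans (BTensor.tmul_add ..)
    | add z w hz hw =>
      refine (map_add _ z w).trans ((congrArg₂ (· + ·) hz hw).trans ?_)
      refine (add_add_add_comm ..).trans ?_
      exact (congrArg₂ (· + ·) (map_add _ z w) (map_add _ z w)).symm
  mul_smul s t z := by
    induction z using BTensor.induction with
    | tmul x y => exact congrArg (BTensor.tmul R x) (mul_assoc y t.unop s.unop).symm
    | add z w hz hw =>
      refine (map_add _ z w).trans ((congrArg₂ (· + ·) hz hw).trans ?_)
      exact ((congrArg _ (map_add _ z w)).trans (map_add _ _ _)).symm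

/-- The left module `R ⊗_R M`. -/
instance tensorModuleLeft (M : Type v) [AddCommGroup M] [NonunitalModule R M] :
    NonunitalModule R (BTensor R R M) where
  smul s z := BTensor.mapLeft (R := R) M (AddMonoidHom.mulLeft s)
    (fun r y => (mul_assoc s y r.unop).symm) z
  smul_add s z w := map_add _ z w
  add_smul s t z := by
    induction z using BTensor.induction with
    | tmul x y => exact (congrArg (BTensor.tmul R · y) (add_mul s t x)).trans (BTensor.add_tmul ..)
    | add z w hz hw =>
      refine (map_add _ z w).trans ((congrArg₂ (· + ·) hz hw).trans ?_)
      refine (add_add_add_comm ..).trans ?_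
      exact (congrArg₂ (· + ·) (map_add _ z w) (map_add _ z w)).symm
  mul_smul s t z := by
    induction z using BTensor.induction with
    | tmul x y => exact congrArg (BTensor.tmul R · y) (mul_assoc s t x)
    | add z w hz hw =>
      refine (map_add _ z w).trans ((congrArg₂ (· + ·) hz hw).trans ?_)
      exact ((congrArg _ (map_add _ z w)).trans (map_add _ _ _)).symm

/-- The homomorphism `f ⊗ R` of right modules. -/
def Hom.rTensor {N : Type v} [AddCommGroup N] [NonunitalModule Rᵐᵒᵖ N]
    {N' : Type w} [AddCommGroup N'] [NonunitalModule Rᵐᵒᵖ N'] (f : Hom Rᵐᵒᵖ N N') :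
    Hom Rᵐᵒᵖ (BTensor R N R) (BTensor R N' R) :=
  { BTensor.mapLeft (R := R) R f.toAddMonoidHom f.map_smul with
    map_smul' := fun s z => by
      change BTensor.mapLeft (R := R) R f.toAddMonoidHom f.map_smul (s • z) =
        s • BTensor.mapLeft (R := R) R f.toAddMonoidHom f.map_smul z
      induction z using BTensor.induction with
      | tmul x y => rfl
      | add z w hz hw =>
        rw [NonunitalModule.smul_add, map_add, map_add, NonunitalModule.smul_add, hz, hw] }

/-- The homomorphism `R ⊗ f` of left modules. -/
def Hom.lTensor {M : Type v} [AddCommGroup M] [NonunitalModule R M]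
    {M' : Type w} [AddCommGroup M'] [NonunitalModule R M'] (f : Hom R M M') :
    Hom R (BTensor R R M) (BTensor R R M') :=
  { BTensor.mapRight (R := R) R f.toAddMonoidHom f.map_smul with
    map_smul' := fun s z => by
      change BTensor.mapRight (R := R) R f.toAddMonoidHom f.map_smul (s • z) =
        s • BTensor.mapRight (R := R) R f.toAddMonoidHom f.map_smul z
      induction z using BTensor.induction with
      | tmul x y => rfl
      | add z w hz hw =>
        rw [NonunitalModule.smul_add, map_add, map_add, NonunitalModule.smul_add, hz, hw] }

/-- The natural map `N ⊗_R R → N` as a homomorphism of right modules. -/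
def rightUnitHom (N : Type v) [AddCommGroup N] [NonunitalModule Rᵐᵒᵖ N] :
    Hom Rᵐᵒᵖ (BTensor R N R) N :=
  { rightUnitMap R N with
    map_smul' := fun s z => by
      change rightUnitMap R N (s • z) = s • rightUnitMap R N z
      induction z using BTensor.induction with
      | tmul x y => exact NonunitalModule.mul_smul s (op y) x
      | add z w hz hw =>
        rw [NonunitalModule.smul_add, map_add, map_add, NonunitalModule.smul_add, hz, hw] }

/-- The natural map `R ⊗_R M → M` as a homomorphism of left modules. -/
def leftUnitHom (M : Type v) [AddCommGroup M] [NonunitalModule R M] :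
    Hom R (BTensor R R M) M :=
  { leftUnitMap R M with
    map_smul' := fun s z => by
      change leftUnitMap R M (s • z) = s • leftUnitMap R M z
      induction z using BTensor.induction with
      | tmul x y => exact NonunitalModule.mul_smul s x y
      | add z w hz hw =>
        rw [NonunitalModule.smul_add, map_add, map_add, NonunitalModule.smul_add, hz, hw] }

/-- A t-unital left module is generated by the products `r x`. -/
theorem TUnitalLeft.induction {M : Type v} [AddCommGroup M] [NonunitalModule R M]
    (hM : TUnitalLeft R M) {P : M → Prop} (smul : ∀ (r : R) (x : M), P (r • x))
    (add : ∀ x y, P x → P y → P (x + y)) (x : M) : P x := by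
  obtain ⟨z, rfl⟩ := hM.2 x
  induction z using BTensor.induction with
  | tmul r x => exact smul r x
  | add z w hz hw => rw [map_add]; exact add _ _ hz hw

/-- A t-unital right module is generated by the products `x r`. -/
theorem TUnitalRight.induction {N : Type v} [AddCommGroup N] [NonunitalModule Rᵐᵒᵖ N]
    (hN : TUnitalRight R N) {P : N → Prop} (smul : ∀ (r : R) (x : N), P (op r • x))
    (add : ∀ x y, P x → P y → P (x + y)) (x : N) : P x := by
  obtain ⟨z, rfl⟩ := hN.2 x
  induction z using BTensor.induction with
  | tmul x r => exact smul r x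
  | add z w hz hw => rw [map_add]; exact add _ _ hz hw

/-- The zero module must lie in the t-unital subcategory in order to serve there as the kernel of a
monomorphism. -/
theorem tUnitalLeft_punit : TUnitalLeft R PUnit.{w + 1} := by
  refine ⟨fun z w _ => ?_, fun x => ⟨0, rfl⟩⟩
  have h : ∀ z : BTensor R R PUnit.{w + 1}, z = 0 := fun z => by
    induction z using BTensor.induction with
    | tmul x y => exact BTensor.tmul_zero x
    | add z w hz hw => rw [hz, hw, add_zero]
  rw [h z, h w]

theorem tUnitalRight_punit : TUnitalRight R PUnit.{w + 1} := by
  refine ⟨fun z w _ => ?_, fun x => ⟨0, rfl⟩⟩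
  have h : ∀ z : BTensor R PUnit.{w + 1} R, z = 0 := fun z => by
    induction z using BTensor.induction with
    | tmul x y => exact BTensor.zero_tmul y
    | add z w hz hw => rw [hz, hw, add_zero]
  rw [h z, h w]

theorem TUnitalRing.tUnitalLeft (hR : TUnitalRing R) : TUnitalLeft R R := hR

/-- On `R ⊗_R R` both unit maps are the multiplication of `R`, so the condition is left-right
symmetric. -/
theorem TUnitalRing.tUnitalRight (hR : TUnitalRing R) : TUnitalRight R R := by
  have h : rightUnitMap R R = leftUnitMap R R := BTensor.hom_ext fun _ _ => rfl
  rwa [TUnitalRight, h]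

end TensorModules

/-! ### Absorbing a factor `R` into a t-unital module. -/

section Associativity

variable {R : Type u} [NonUnitalRing R]

/-- For a t-unital left module `F`, the map `(N ⊗_R R) ⊗_R F → N ⊗_R F` is an isomorphism. -/
theorem TUnitalLeft.bijective_mapLeft_rightUnitHom {F : Type v} [AddCommGroup F]
    [NonunitalModule R F] (hF : TUnitalLeft R F) (N : Type w) [AddCommGroup N]
    [NonunitalModule Rᵐᵒᵖ N] :
    Function.Bijective (BTensor.mapLeft (R := R) F (rightUnitHom (R := R) N).toAddMonoidHom
      (rightUnitHom (R := R) N).map_smul) := by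
  set e := BTensor.mapLeft (R := R) F (rightUnitHom (R := R) N).toAddMonoidHom
      (rightUnitHom (R := R) N).map_smul
  have he : ∀ (x : N) (r : R) (y : F), e (BTensor.tmul R (BTensor.tmul R x r) y) =
      BTensor.tmul R x (r • y) := fun x r y => BTensor.smul_tmul x r y
  let μ : BTensor R R F ≃+ F := AddEquiv.ofBijective (leftUnitMap R F) hF
  have hμ : ∀ (r : R) (y : F), μ.symm (r • y) = BTensor.tmul R r y := fun r y =>
    μ.symm_apply_eq.2 rfl
  -- The inverse should send `x ⊗ r y` to `(x ⊗ r) ⊗ y`. It is well defined because `μ.symm`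
  -- recovers `r ⊗ y` from `r y`; `tm x` is then `r ⊗ y ↦ (x ⊗ r) ⊗ y`.
  let tm : N → BTensor R R F →+ BTensor R (BTensor R N R) F := fun x =>
    BTensor.mapLeft (R := R) F (BTensor.tmulHom R N R x) fun _ _ => rfl
  let b : N →+ F →+ BTensor R (BTensor R N R) F :=
    AddMonoidHom.mk' (fun x => (tm x).comp μ.symm.toAddMonoidHom) fun x x' => by
      refine AddMonoidHom.ext fun y => ?_
      have h : tm (x + x') = tm x + tm x' := BTensor.hom_ext fun r y =>
        (congrArg (BTensor.tmul R · y) (BTensor.add_tmul x x' r)).trans (BTensor.add_tmul ..)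
      exact DFunLike.congr_fun h _
  have hb : ∀ (x : N) (r : R) (y : F), b x (r • y) = BTensor.tmul R (BTensor.tmul R x r) y :=
    fun x r y => congrArg (tm x) (hμ r y)
  let s : BTensor R N F →+ BTensor R (BTensor R N R) F := BTensor.lift b fun x t y => by
    -- Balancedness need only be checked on products `r y`, where the explicit formula `hb` for `b`
    -- is available.
    induction y using hF.induction with
    | smul r y => rw [← NonunitalModule.mul_smul, hb, hb, BTensor.smul_tmul]; rfl
    | add y y' h h' => rw [NonunitalModule.smul_add, map_add, map_add, h, h']
  have hs : ∀ z, s (e z) = z := fun z => by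
    induction z using BTensor.induction with
    | tmul z y =>
      induction z using BTensor.induction with
      | tmul x r => rw [he]; exact hb x r y
      | add z w hz hw => rw [BTensor.add_tmul, map_add, map_add, hz, hw]
    | add z w hz hw => rw [map_add, map_add, hz, hw]
  refine ⟨Function.LeftInverse.injective hs, fun z => ?_⟩
  induction z using BTensor.induction with
  | tmul x y =>
    induction y using hF.induction with
    | smul r y => exact ⟨_, he x r y⟩
    | add y y' h h' =>
      obtain ⟨z, hz⟩ := h
      obtain ⟨w, hw⟩ := h'
      exact ⟨z + w, by rw [map_add, hz, hw, BTensor.tmul_add]⟩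
  | add z w hz hw =>
    obtain ⟨z, rfl⟩ := hz
    obtain ⟨w, rfl⟩ := hw
    exact ⟨z + w, map_add _ z w⟩

/-- For a t-unital right module `F`, the map `F ⊗_R (R ⊗_R M) → F ⊗_R M` is an isomorphism. -/
theorem TUnitalRight.bijective_mapRight_leftUnitHom {F : Type v} [AddCommGroup F]
    [NonunitalModule Rᵐᵒᵖ F] (hF : TUnitalRight R F) (M : Type w) [AddCommGroup M]
    [NonunitalModule R M] :
    Function.Bijective (BTensor.mapRight (R := R) F (leftUnitHom (R := R) M).toAddMonoidHom
      (leftUnitHom (R := R) M).map_smul) := by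
  set e := BTensor.mapRight (R := R) F (leftUnitHom (R := R) M).toAddMonoidHom
      (leftUnitHom (R := R) M).map_smul
  have he : ∀ (y : F) (r : R) (x : M), e (BTensor.tmul R y (BTensor.tmul R r x)) =
      BTensor.tmul R (op r • y) x := fun y r x => (BTensor.smul_tmul y r x).symm
  let μ : BTensor R F R ≃+ F := AddEquiv.ofBijective (rightUnitMap R F) hF
  have hμ : ∀ (r : R) (y : F), μ.symm (op r • y) = BTensor.tmul R y r := fun r y =>
    μ.symm_apply_eq.2 rfl
  let tm : M → BTensor R F R →+ BTensor R F (BTensor R R M) := fun x =>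
    BTensor.mapRight (R := R) F ((BTensor.tmulHom R R M).flip x) fun _ _ => rfl
  let b : M →+ F →+ BTensor R F (BTensor R R M) :=
    AddMonoidHom.mk' (fun x => (tm x).comp μ.symm.toAddMonoidHom) fun x x' => by
      refine AddMonoidHom.ext fun y => ?_
      have h : tm (x + x') = tm x + tm x' := BTensor.hom_ext fun y r =>
        (congrArg (BTensor.tmul R y) (BTensor.tmul_add r x x')).trans (BTensor.tmul_add ..)
      exact DFunLike.congr_fun h _
  have hb : ∀ (x : M) (r : R) (y : F), b.flip (op r • y) x =
      BTensor.tmul R y (BTensor.tmul R r x) := fun x r y => congrArg (tm x) (hμ r y)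
  let s : BTensor R F M →+ BTensor R F (BTensor R R M) := BTensor.lift b.flip fun y t x => by
    induction y using hF.induction with
    | smul r y =>
      rw [← NonunitalModule.mul_smul, ← op_mul, hb, hb, ← BTensor.smul_tmul]; rfl
    | add y y' h h' =>
      rw [NonunitalModule.smul_add, map_add, map_add, AddMonoidHom.add_apply,
        AddMonoidHom.add_apply, h, h']
  have hs : ∀ z, s (e z) = z := fun z => by
    induction z using BTensor.induction with
    | tmul y z =>
      induction z using BTensor.induction with
      | tmul r x => rw [he]; exact hb x r y
      | add z w hz hw => rw [BTensor.tmul_add, map_add, map_add, hz, hw]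
    | add z w hz hw => rw [map_add, map_add, hz, hw]
  refine ⟨Function.LeftInverse.injective hs, fun z => ?_⟩
  induction z using BTensor.induction with
  | tmul y x =>
    induction y using hF.induction with
    | smul r y => exact ⟨_, he y r x⟩
    | add y y' h h' =>
      obtain ⟨z, hz⟩ := h
      obtain ⟨w, hw⟩ := h'
      exact ⟨z + w, by rw [map_add, hz, hw, BTensor.add_tmul]⟩
  | add z w hz hw =>
    obtain ⟨z, rfl⟩ := hz
    obtain ⟨w, rfl⟩ := hw
    exact ⟨z + w, map_add _ z w⟩

/-- Balancing gives `x ⊗ r s = x r ⊗ s`, so the unit map of `N ⊗_R R` equals the unit map of `N`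
tensored with `R`. The latter is bijective by the absorption isomorphism with `F = R`. -/
theorem TUnitalRing.tUnitalRight_tensor (hR : TUnitalRing R) (N : Type w) [AddCommGroup N]
    [NonunitalModule Rᵐᵒᵖ N] : TUnitalRight R (BTensor R N R) := by
  have h : rightUnitMap R (BTensor R N R) = BTensor.mapLeft (R := R) R
      (rightUnitHom (R := R) N).toAddMonoidHom (rightUnitHom (R := R) N).map_smul :=
    BTensor.hom_ext fun z s => by
      induction z using BTensor.induction with
      | tmul x r => exact (BTensor.smul_tmul x r s).symm
      | add z w hz hw => rw [BTensor.add_tmul, map_add, map_add, hz, hw]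
  rw [TUnitalRight, h]
  exact hR.tUnitalLeft.bijective_mapLeft_rightUnitHom N

theorem TUnitalRing.tUnitalLeft_tensor (hR : TUnitalRing R) (M : Type w) [AddCommGroup M]
    [NonunitalModule R M] : TUnitalLeft R (BTensor R R M) := by
  have h : leftUnitMap R (BTensor R R M) = BTensor.mapRight (R := R) R
      (leftUnitHom (R := R) M).toAddMonoidHom (leftUnitHom (R := R) M).map_smul :=
    BTensor.hom_ext fun s z => by
      induction z using BTensor.induction with
      | tmul r x => exact BTensor.smul_tmul s r x
      | add z w hz hw => rw [BTensor.tmul_add, map_add, map_add, hz, hw]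
  rw [TUnitalLeft, h]
  exact hR.tUnitalRight.bijective_mapRight_leftUnitHom M

end Associativity

/-! ### Flatness over the unitalization in terms of nonunital modules -/

section Unitization

variable {R : Type u} [NonUnitalRing R] {A : Type u} [Ring A] (j : R →ₙ+* A)

/-- The nonunital left `R`-module underlying a unital left `A`-module. -/
abbrev restrictModule (M : Type v) [AddCommGroup M] [Module A M] : NonunitalModule R M where
  smul r x := j r • x
  smul_add r x y := _root_.smul_add (j r) x y
  add_smul r s x := by
    change j (r + s) • x = j r • x + j s • x
    rw [map_add, _root_.add_smul]
  mul_smul r s x := by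
    change j (r * s) • x = j r • j s • x
    rw [map_mul, SemigroupAction.mul_smul]

/-- The nonunital right `R`-module underlying a unital right `A`-module. -/
abbrev restrictModuleRight (M : Type v) [AddCommGroup M] [Module Aᵐᵒᵖ M] :
    NonunitalModule Rᵐᵒᵖ M where
  smul r x := op (j r.unop) • x
  smul_add r x y := _root_.smul_add (op (j r.unop)) x y
  add_smul r s x := by
    change op (j (r + s).unop) • x = op (j r.unop) • x + op (j s.unop) • x
    rw [unop_add, map_add, op_add, _root_.add_smul]
  mul_smul r s x := by
    change op (j (r * s).unop) • x = op (j r.unop) • op (j s.unop) • x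
    rw [unop_mul, map_mul, op_mul, SemigroupAction.mul_smul]

variable {j}

/-- Integers already pass across `⊗_ℤ`, so for `a = n + j r` the relation for `a` reduces to the
relation for `r`. The two actions are separate data linked by `hN` and `hM`; this covers both
`A`-actions extended from `R` and `R`-actions restricted from `A`. -/
theorem balancedRel_eq_of_ringHom
    (hj : ∀ a : A, ∃ (n : ℤ) (r : R), a = n + j r)
    (N : Type v) (M : Type w) [AddCommGroup N] [AddCommGroup M]
    [Module Aᵐᵒᵖ N] [SMul Rᵐᵒᵖ N] [Module A M] [SMul R M]
    (hN : ∀ (r : R) (x : N), op (j r) • x = op r • x)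
    (hM : ∀ (r : R) (x : M), j r • x = r • x) :
    balancedRel R N M = balancedRel A N M := by
  refine le_antisymm ((AddSubgroup.closure_le _).2 ?_) ((AddSubgroup.closure_le _).2 ?_)
  · rintro _ ⟨x, r, y, rfl⟩
    exact AddSubgroup.subset_closure ⟨x, j r, y, by rw [hN, hM]⟩
  · rintro _ ⟨x, a, y, rfl⟩
    obtain ⟨n, r, rfl⟩ := hj a
    refine AddSubgroup.subset_closure ⟨x, r, y, ?_⟩
    rw [op_add, _root_.add_smul, _root_.add_smul, hN, hM, op_intCast, Int.cast_smul_eq_zsmul,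
      Int.cast_smul_eq_zsmul, TensorProduct.add_tmul, TensorProduct.tmul_add,
      TensorProduct.smul_tmul, add_sub_add_left_eq_sub]

/-- Tensor products over `R` and over `A` agree. -/
def BTensor.equivOfRingHom
    (hj : ∀ a : A, ∃ (n : ℤ) (r : R), a = n + j r)
    (N : Type v) (M : Type w) [AddCommGroup N] [AddCommGroup M]
    [Module Aᵐᵒᵖ N] [SMul Rᵐᵒᵖ N] [Module A M] [SMul R M]
    (hN : ∀ (r : R) (x : N), op (j r) • x = op r • x)
    (hM : ∀ (r : R) (x : M), j r • x = r • x) :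
    BTensor R N M ≃+ BTensor A N M :=
  QuotientAddGroup.quotientAddEquivOfEq (balancedRel_eq_of_ringHom hj N M hN hM)

/-- A left module is flat over `A` iff tensoring with it preserves injections of nonunital
right `R`-modules. -/
theorem flatLeft_iff_of_ringHom
    (hj : ∀ a : A, ∃ (n : ℤ) (r : R), a = n + j r)
    (F : Type v) [AddCommGroup F]
    [NonunitalModule R F] [Module A F] (hF : ∀ (r : R) (x : F), j r • x = r • x)
    (hext : ∀ (N : Type (max u v)) [AddCommGroup N] [NonunitalModule Rᵐᵒᵖ N], ∃ _ : Module Aᵐᵒᵖ N,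
      ∀ (r : R) (x : N), op (j r) • x = op r • x) :
    FlatLeft A F ↔ ∀ (N N' : Type (max u v)) [AddCommGroup N] [NonunitalModule Rᵐᵒᵖ N]
      [AddCommGroup N'] [NonunitalModule Rᵐᵒᵖ N'] (f : Hom Rᵐᵒᵖ N N'),
      Function.Injective f.toAddMonoidHom →
      Function.Injective (BTensor.mapLeft (R := R) F f.toAddMonoidHom f.map_smul) := by
  constructor
  · intro h N N' _ _ _ _ f hf
    obtain ⟨_, hN⟩ := hext N
    obtain ⟨_, hN'⟩ := hext N'
    let g : N →ₗ[Aᵐᵒᵖ] N' :=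
      { f.toAddMonoidHom with
        map_smul' := fun a x => by
          change f.toAddMonoidHom (op a.unop • x) = op a.unop • f.toAddMonoidHom x
          -- Additivity handles the integer part of `a.unop`, and `R`-linearity the rest.
          obtain ⟨n, r, h⟩ := hj a.unop
          rw [h, op_add, _root_.add_smul, _root_.add_smul, hN, hN', op_intCast,
            Int.cast_smul_eq_zsmul, Int.cast_smul_eq_zsmul, map_add, map_zsmul, f.map_smul] }
    have key : ∀ z, BTensor.equivOfRingHom hj N' F hN' hF
        (BTensor.mapLeft (R := R) F f.toAddMonoidHom f.map_smul z) =
        BTensor.mapLeft (R := A) F g.toAddMonoidHom (linear_map_smul g)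
          (BTensor.equivOfRingHom hj N F hN hF z) := fun z => by
      induction z using BTensor.induction with
      | tmul x y => rfl
      | add z w hz hw => simp only [map_add, hz, hw]
    intro z w hzw
    apply (BTensor.equivOfRingHom hj N F hN hF).injective
    apply h N N' g hf
    rw [← key, ← key, hzw]
  · intro h N N' _ _ _ _ g hg
    let _ := restrictModuleRight j N
    let _ := restrictModuleRight j N'
    have hN : ∀ (r : R) (x : N), op (j r) • x = op r • x := fun _ _ => rfl
    have hN' : ∀ (r : R) (x : N'), op (j r) • x = op r • x := fun _ _ => rfl
    let f : Hom Rᵐᵒᵖ N N' :=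
      { g.toAddMonoidHom with map_smul' := fun r x => g.map_smul (op (j r.unop)) x }
    have key : ∀ z, BTensor.equivOfRingHom hj N' F hN' hF
        (BTensor.mapLeft (R := R) F f.toAddMonoidHom f.map_smul z) =
        BTensor.mapLeft (R := A) F g.toAddMonoidHom (linear_map_smul g)
          (BTensor.equivOfRingHom hj N F hN hF z) := fun z => by
      induction z using BTensor.induction with
      | tmul x y => rfl
      | add z w hz hw => simp only [map_add, hz, hw]
    intro z w hzw
    obtain ⟨z, rfl⟩ := (BTensor.equivOfRingHom hj N F hN hF).surjective z
    obtain ⟨w, rfl⟩ := (BTensor.equivOfRingHom hj N F hN hF).surjective w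
    rw [← key, ← key] at hzw
    exact congrArg _ (h N N' f hg ((BTensor.equivOfRingHom hj N' F hN' hF).injective hzw))

/-- A right module is flat over `A` iff tensoring with it preserves injections of nonunital
left `R`-modules. -/
theorem flatRight_iff_of_ringHom
    (hj : ∀ a : A, ∃ (n : ℤ) (r : R), a = n + j r)
    (F : Type v) [AddCommGroup F]
    [NonunitalModule Rᵐᵒᵖ F] [Module Aᵐᵒᵖ F] (hF : ∀ (r : R) (x : F), op (j r) • x = op r • x)
    (hext : ∀ (N : Type (max u v)) [AddCommGroup N] [NonunitalModule R N], ∃ _ : Module A N,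
      ∀ (r : R) (x : N), j r • x = r • x) :
    FlatRight A F ↔ ∀ (N N' : Type (max u v)) [AddCommGroup N] [NonunitalModule R N]
      [AddCommGroup N'] [NonunitalModule R N'] (f : Hom R N N'),
      Function.Injective f.toAddMonoidHom →
      Function.Injective (BTensor.mapRight (R := R) F f.toAddMonoidHom f.map_smul) := by
  constructor
  · intro h N N' _ _ _ _ f hf
    obtain ⟨_, hN⟩ := hext N
    obtain ⟨_, hN'⟩ := hext N'
    let g : N →ₗ[A] N' :=
      { f.toAddMonoidHom with
        map_smul' := fun a x => by
          change f.toAddMonoidHom (a • x) = a • f.toAddMonoidHom x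
          obtain ⟨n, r, rfl⟩ := hj a
          rw [_root_.add_smul, _root_.add_smul, hN, hN', Int.cast_smul_eq_zsmul,
            Int.cast_smul_eq_zsmul, map_add, map_zsmul, f.map_smul] }
    have key : ∀ z, BTensor.equivOfRingHom hj F N' hF hN'
        (BTensor.mapRight (R := R) F f.toAddMonoidHom f.map_smul z) =
        BTensor.mapRight (R := A) F g.toAddMonoidHom (linear_map_smul g)
          (BTensor.equivOfRingHom hj F N hF hN z) := fun z => by
      induction z using BTensor.induction with
      | tmul x y => rfl
      | add z w hz hw => simp only [map_add, hz, hw]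
    intro z w hzw
    apply (BTensor.equivOfRingHom hj F N hF hN).injective
    apply h N N' g hf
    rw [← key, ← key, hzw]
  · intro h N N' _ _ _ _ g hg
    let _ := restrictModule j N
    let _ := restrictModule j N'
    have hN : ∀ (r : R) (x : N), j r • x = r • x := fun _ _ => rfl
    have hN' : ∀ (r : R) (x : N'), j r • x = r • x := fun _ _ => rfl
    let f : Hom R N N' :=
      { g.toAddMonoidHom with map_smul' := fun r x => g.map_smul (j r) x }
    have key : ∀ z, BTensor.equivOfRingHom hj F N' hF hN'
        (BTensor.mapRight (R := R) F f.toAddMonoidHom f.map_smul z) =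
        BTensor.mapRight (R := A) F g.toAddMonoidHom (linear_map_smul g)
          (BTensor.equivOfRingHom hj F N hF hN z) := fun z => by
      induction z using BTensor.induction with
      | tmul x y => rfl
      | add z w hz hw => simp only [map_add, hz, hw]
    intro z w hzw
    obtain ⟨z, rfl⟩ := (BTensor.equivOfRingHom hj F N hF hN).surjective z
    obtain ⟨w, rfl⟩ := (BTensor.equivOfRingHom hj F N hF hN).surjective w
    rw [← key, ← key] at hzw
    exact congrArg _ (h N N' f hg ((BTensor.equivOfRingHom hj F N' hF hN').injective hzw))

/-- The inclusion of `R` in `ℤ ⊕ R`. -/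
def unitizationInr (R : Type u) [NonUnitalRing R] : R →ₙ+* Unitization ℤ R where
  toFun := Unitization.inr
  map_mul' := Unitization.inr_mul ℤ
  map_zero' := Unitization.inr_zero ℤ
  map_add' := Unitization.inr_add ℤ

theorem unitization_eq_add_inr (a : Unitization ℤ R) :
    ∃ (n : ℤ) (r : R), a = n + unitizationInr R r :=
  ⟨a.fst, a.snd, by
    have h : ((a.fst : ℤ) : Unitization ℤ R) = Unitization.inl a.fst :=
      (map_intCast (Unitization.inlRingHom ℤ R) a.fst).symm
    rw [h]
    exact (Unitization.inl_fst_add_inr_snd_eq a).symm⟩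

theorem unitizationModule_inr_smul (M : Type v) [AddCommGroup M] [NonunitalModule R M] (r : R)
    (x : M) :
    letI := unitizationModule R M
    (r : Unitization ℤ R) • x = r • x := by
  change (0 : ℤ) • x + r • x = r • x
  rw [zero_zsmul, zero_add]

theorem unitizationModuleRight_inr_smul (M : Type v) [AddCommGroup M] [NonunitalModule Rᵐᵒᵖ M]
    (r : R) (x : M) :
    letI := unitizationModuleRight R M
    op (r : Unitization ℤ R) • x = op r • x := by
  change (0 : ℤ) • x + op r • x = op r • x
  rw [zero_zsmul, zero_add]

/-- A left module is flat over `ℤ ⊕ R` iff tensoring with it preserves injections of nonunital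
right `R`-modules. -/
theorem flatNonunitalLeft_iff (F : Type v) [AddCommGroup F] [NonunitalModule R F] :
    FlatNonunitalLeft R F ↔ ∀ (N N' : Type (max u v)) [AddCommGroup N] [NonunitalModule Rᵐᵒᵖ N]
      [AddCommGroup N'] [NonunitalModule Rᵐᵒᵖ N'] (f : Hom Rᵐᵒᵖ N N'),
      Function.Injective f.toAddMonoidHom →
      Function.Injective (BTensor.mapLeft (R := R) F f.toAddMonoidHom f.map_smul) := by
  let _ := unitizationModule R F
  exact flatLeft_iff_of_ringHom (j := unitizationInr R) unitization_eq_add_inr F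
    (unitizationModule_inr_smul F)
    fun N _ _ => ⟨unitizationModuleRight R N, unitizationModuleRight_inr_smul N⟩

/-- A right module is flat over `ℤ ⊕ R` iff tensoring with it preserves injections of nonunital
left `R`-modules. -/
theorem flatNonunitalRight_iff (F : Type v) [AddCommGroup F] [NonunitalModule Rᵐᵒᵖ F] :
    FlatNonunitalRight R F ↔ ∀ (N N' : Type (max u v)) [AddCommGroup N] [NonunitalModule R N]
      [AddCommGroup N'] [NonunitalModule R N'] (f : Hom R N N'),
      Function.Injective f.toAddMonoidHom →
      Function.Injective (BTensor.mapRight (R := R) F f.toAddMonoidHom f.map_smul) := by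
  let _ := unitizationModuleRight R F
  exact flatRight_iff_of_ringHom (j := unitizationInr R) unitization_eq_add_inr F
    (unitizationModuleRight_inr_smul F)
    fun N _ _ => ⟨unitizationModule R N, unitizationModule_inr_smul N⟩

end Unitization

/-! ### Comparison of kernels, and the two implications. -/

section Flatness

variable {R : Type u} [NonUnitalRing R]

/-- Factor `h` through its range: flatness keeps the inclusion injective after tensoring, and right
exactness describes the kernel of the surjection. -/
theorem FlatNonunitalLeft.mem_closure_of_mapLeft_eq_zero {F : Type v} [AddCommGroup F]
    [NonunitalModule R F] (hF : FlatNonunitalLeft R F) {X Y : Type (max u v)} [AddCommGroup X]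
    [NonunitalModule Rᵐᵒᵖ X] [AddCommGroup Y] [NonunitalModule Rᵐᵒᵖ Y] (h : Hom Rᵐᵒᵖ X Y)
    {z : BTensor R X F} (hz : BTensor.mapLeft (R := R) F h.toAddMonoidHom h.map_smul z = 0) :
    z ∈ AddSubgroup.closure {t | ∃ x y, h.toAddMonoidHom x = 0 ∧ t = BTensor.tmul R x y} := by
  let ι : Hom Rᵐᵒᵖ h.toAddMonoidHom.range Y :=
    { h.toAddMonoidHom.range.subtype with map_smul' := fun _ _ => rfl }
  let p : X →+ h.toAddMonoidHom.range := h.toAddMonoidHom.rangeRestrict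
  have hp : ∀ (r : Rᵐᵒᵖ) (x : X), p (r • x) = r • p x := fun r x => Subtype.ext (h.map_smul r x)
  have hcomp : (BTensor.mapLeft (R := R) F ι.toAddMonoidHom ι.map_smul).comp
      (BTensor.mapLeft (R := R) F p hp) = BTensor.mapLeft (R := R) F h.toAddMonoidHom h.map_smul :=
    BTensor.hom_ext fun _ _ => rfl
  have hpz : BTensor.mapLeft (R := R) F p hp z = 0 := by
    apply (flatNonunitalLeft_iff F).1 hF _ _ ι Subtype.val_injective
    rw [map_zero, ← hz, ← hcomp, AddMonoidHom.comp_apply]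
  have hker : ∀ x, h.toAddMonoidHom x = 0 ↔ p x = 0 := fun x =>
    (Subtype.ext_iff (a1 := p x) (a2 := 0)).symm
  simp only [hker]
  exact BTensor.mem_closure_of_mapLeft_eq_zero p hp
    h.toAddMonoidHom.rangeRestrict_surjective hpz

theorem FlatNonunitalRight.mem_closure_of_mapRight_eq_zero {F : Type v} [AddCommGroup F]
    [NonunitalModule Rᵐᵒᵖ F] (hF : FlatNonunitalRight R F) {X Y : Type (max u v)} [AddCommGroup X]
    [NonunitalModule R X] [AddCommGroup Y] [NonunitalModule R Y] (h : Hom R X Y)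
    {z : BTensor R F X} (hz : BTensor.mapRight (R := R) F h.toAddMonoidHom h.map_smul z = 0) :
    z ∈ AddSubgroup.closure {t | ∃ x y, h.toAddMonoidHom y = 0 ∧ t = BTensor.tmul R x y} := by
  let ι : Hom R h.toAddMonoidHom.range Y :=
    { h.toAddMonoidHom.range.subtype with map_smul' := fun _ _ => rfl }
  let p : X →+ h.toAddMonoidHom.range := h.toAddMonoidHom.rangeRestrict
  have hp : ∀ (r : R) (x : X), p (r • x) = r • p x := fun r x => Subtype.ext (h.map_smul r x)
  have hcomp : (BTensor.mapRight (R := R) F ι.toAddMonoidHom ι.map_smul).comp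
      (BTensor.mapRight (R := R) F p hp) =
        BTensor.mapRight (R := R) F h.toAddMonoidHom h.map_smul :=
    BTensor.hom_ext fun _ _ => rfl
  have hpz : BTensor.mapRight (R := R) F p hp z = 0 := by
    apply (flatNonunitalRight_iff F).1 hF _ _ ι Subtype.val_injective
    rw [map_zero, ← hz, ← hcomp, AddMonoidHom.comp_apply]
  have hker : ∀ x, h.toAddMonoidHom x = 0 ↔ p x = 0 := fun x =>
    (Subtype.ext_iff (a1 := p x) (a2 := 0)).symm
  simp only [hker]
  exact BTensor.mem_closure_of_mapRight_eq_zero p hp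
    h.toAddMonoidHom.rangeRestrict_surjective hpz

/-- Composition of homomorphisms. -/
def Hom.comp {S : Type*} [NonUnitalRing S] {X Y Z : Type*} [AddCommGroup X]
    [NonunitalModule S X] [AddCommGroup Y] [NonunitalModule S Y] [AddCommGroup Z]
    [NonunitalModule S Z] (g : Hom S Y Z) (f : Hom S X Y) : Hom S X Z :=
  { g.toAddMonoidHom.comp f.toAddMonoidHom with
    map_smul' := fun r x => (congrArg g.toAddMonoidHom (f.map_smul r x)).trans (g.map_smul r _) }

/-- The inclusion of the kernel. -/
def Hom.kerSubtype {S : Type*} [NonUnitalRing S] {X Y : Type*} [AddCommGroup X]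
    [NonunitalModule S X] [AddCommGroup Y] [NonunitalModule S Y] (f : Hom S X Y) :
    Hom S f.toAddMonoidHom.ker X :=
  { f.toAddMonoidHom.ker.subtype with map_smul' := fun _ _ => rfl }

/-- `R` annihilates every element that a kernel in the category of t-unital right modules maps to `0`. -/
theorem IsKernelIn.op_smul_eq_zero (hR : TUnitalRing R) {K L M : Type (max u v)} [AddCommGroup K]
    [NonunitalModule Rᵐᵒᵖ K] [AddCommGroup L] [NonunitalModule Rᵐᵒᵖ L] [AddCommGroup M]
    [NonunitalModule Rᵐᵒᵖ M] {i : Hom Rᵐᵒᵖ K L} {f : Hom Rᵐᵒᵖ L M}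
    (h : IsKernelIn (fun X _ _ => TUnitalRight R X) i f) (x : K) (hx : i.toAddMonoidHom x = 0)
    (r : R) : op r • x = 0 := by
  obtain ⟨-, -, -, -, h⟩ := h
  -- `ker i` may fail to be t-unital, but `(ker i) ⊗_R R` is a legitimate test object. Both `g` and
  -- zero lift the zero map, so uniqueness gives `g = 0`; its value at `x ⊗ r` is `x r`.
  let g : Hom Rᵐᵒᵖ (BTensor R i.toAddMonoidHom.ker R) K := i.kerSubtype.comp (rightUnitHom _)
  have hg : i.toAddMonoidHom.comp g.toAddMonoidHom = 0 := AddMonoidHom.ext fun z =>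
    (rightUnitHom (R := R) i.toAddMonoidHom.ker |>.toAddMonoidHom z).2
  obtain ⟨_, -, huniq⟩ := h _ (hR.tUnitalRight_tensor i.toAddMonoidHom.ker)
    (Hom.zero Rᵐᵒᵖ _ L) (AddMonoidHom.ext fun _ => map_zero f.toAddMonoidHom)
  have h₁ := huniq g hg
  have h₂ := huniq (Hom.zero Rᵐᵒᵖ _ K) (AddMonoidHom.ext fun _ => map_zero i.toAddMonoidHom)
  exact congrArg (fun φ => φ.toAddMonoidHom (BTensor.tmul R ⟨x, hx⟩ r)) (h₁.trans h₂.symm)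

/-- Products `x r` with `x` in the set-theoretic kernel come from the kernel in the category of
t-unital right modules. -/
theorem IsKernelIn.exists_eq_op_smul (hR : TUnitalRing R) {K L M : Type (max u v)}
    [AddCommGroup K] [NonunitalModule Rᵐᵒᵖ K] [AddCommGroup L] [NonunitalModule Rᵐᵒᵖ L]
    [AddCommGroup M] [NonunitalModule Rᵐᵒᵖ M] {i : Hom Rᵐᵒᵖ K L} {f : Hom Rᵐᵒᵖ L M}
    (h : IsKernelIn (fun X _ _ => TUnitalRight R X) i f) (x : L) (hx : f.toAddMonoidHom x = 0)
    (r : R) : ∃ k, i.toAddMonoidHom k = op r • x := by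
  obtain ⟨-, -, -, -, h⟩ := h
  let g : Hom Rᵐᵒᵖ (BTensor R f.toAddMonoidHom.ker R) L := f.kerSubtype.comp (rightUnitHom _)
  have hg : f.toAddMonoidHom.comp g.toAddMonoidHom = 0 := AddMonoidHom.ext fun z =>
    (rightUnitHom (R := R) f.toAddMonoidHom.ker |>.toAddMonoidHom z).2
  obtain ⟨φ, hφ, -⟩ := h _ (hR.tUnitalRight_tensor f.toAddMonoidHom.ker) g hg
  exact ⟨_, DFunLike.congr_fun hφ (BTensor.tmul R ⟨x, hx⟩ r)⟩

/-- `R` annihilates every element that a kernel in the category of t-unital left modules maps to `0`. -/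
theorem IsKernelIn.smul_eq_zero (hR : TUnitalRing R) {K L M : Type (max u v)} [AddCommGroup K]
    [NonunitalModule R K] [AddCommGroup L] [NonunitalModule R L] [AddCommGroup M]
    [NonunitalModule R M] {i : Hom R K L} {f : Hom R L M}
    (h : IsKernelIn (fun X _ _ => TUnitalLeft R X) i f) (x : K) (hx : i.toAddMonoidHom x = 0)
    (r : R) : r • x = 0 := by
  obtain ⟨-, -, -, -, h⟩ := h
  let g : Hom R (BTensor R R i.toAddMonoidHom.ker) K := i.kerSubtype.comp (leftUnitHom _)
  have hg : i.toAddMonoidHom.comp g.toAddMonoidHom = 0 := AddMonoidHom.ext fun z =>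
    (leftUnitHom (R := R) i.toAddMonoidHom.ker |>.toAddMonoidHom z).2
  obtain ⟨_, -, huniq⟩ := h _ (hR.tUnitalLeft_tensor i.toAddMonoidHom.ker)
    (Hom.zero R _ L) (AddMonoidHom.ext fun _ => map_zero f.toAddMonoidHom)
  have h₁ := huniq g hg
  have h₂ := huniq (Hom.zero R _ K) (AddMonoidHom.ext fun _ => map_zero i.toAddMonoidHom)
  exact congrArg (fun φ => φ.toAddMonoidHom (BTensor.tmul R r ⟨x, hx⟩)) (h₁.trans h₂.symm)

/-- Products `r x` with `x` in the set-theoretic kernel come from the kernel in the category of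
t-unital left modules. -/
theorem IsKernelIn.exists_eq_smul (hR : TUnitalRing R) {K L M : Type (max u v)}
    [AddCommGroup K] [NonunitalModule R K] [AddCommGroup L] [NonunitalModule R L]
    [AddCommGroup M] [NonunitalModule R M] {i : Hom R K L} {f : Hom R L M}
    (h : IsKernelIn (fun X _ _ => TUnitalLeft R X) i f) (x : L) (hx : f.toAddMonoidHom x = 0)
    (r : R) : ∃ k, i.toAddMonoidHom k = r • x := by
  obtain ⟨-, -, -, -, h⟩ := h
  -- The test object is `R ⊗_R (ker f)`; the factorization of `g` through `i`, evaluated at `r ⊗ x`,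
  -- gives the preimage of `r x`.
  let g : Hom R (BTensor R R f.toAddMonoidHom.ker) L := f.kerSubtype.comp (leftUnitHom _)
  have hg : f.toAddMonoidHom.comp g.toAddMonoidHom = 0 := AddMonoidHom.ext fun z =>
    (leftUnitHom (R := R) f.toAddMonoidHom.ker |>.toAddMonoidHom z).2
  obtain ⟨φ, hφ, -⟩ := h _ (hR.tUnitalLeft_tensor f.toAddMonoidHom.ker) g hg
  exact ⟨_, DFunLike.congr_fun hφ (BTensor.tmul R r ⟨x, hx⟩)⟩

/-- For a product `r y` in `F`, the tensor `x ⊗ r y = x r ⊗ y` is zero when `i x = 0`, and comes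
from `K ⊗_R F` when `f x = 0`. -/
theorem FlatNonunitalLeft.tFlatLeft (hR : TUnitalRing R) {F : Type v} [AddCommGroup F]
    [NonunitalModule R F] (hF : TUnitalLeft R F) (hflat : FlatNonunitalLeft R F) :
    TFlatLeft R F := by
  intro K L M _ _ _ _ _ _ i f h
  refine ⟨(injective_iff_map_eq_zero _).2 fun z hz => ?_, fun z => ⟨fun hz => ?_, ?_⟩⟩
  · have hle : AddSubgroup.closure {t : BTensor R K F | ∃ x y, i.toAddMonoidHom x = 0 ∧
        t = BTensor.tmul R x y} ≤ ⊥ := (AddSubgroup.closure_le _).2 <| by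
      rintro _ ⟨x, y, hx, rfl⟩
      change BTensor.tmul R x y = 0
      induction y using hF.induction with
      | smul r y => rw [← BTensor.smul_tmul, h.op_smul_eq_zero hR x hx, BTensor.zero_tmul]
      | add y y' hy hy' => rw [BTensor.tmul_add, hy, hy', add_zero]
    exact hle (hflat.mem_closure_of_mapLeft_eq_zero i hz)
  · have hle : AddSubgroup.closure {t : BTensor R L F | ∃ x y, f.toAddMonoidHom x = 0 ∧
        t = BTensor.tmul R x y} ≤
          (BTensor.mapLeft (R := R) F i.toAddMonoidHom i.map_smul).range :=
      (AddSubgroup.closure_le _).2 <| by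
      rintro _ ⟨x, y, hx, rfl⟩
      rw [SetLike.mem_coe]
      induction y using hF.induction with
      | smul r y =>
        obtain ⟨k, hk⟩ := h.exists_eq_op_smul hR x hx r
        exact ⟨BTensor.tmul R k y, by rw [BTensor.mapLeft_tmul, hk, BTensor.smul_tmul]⟩
      | add y y' hy hy' => rw [BTensor.tmul_add]; exact add_mem hy hy'
    exact hle (hflat.mem_closure_of_mapLeft_eq_zero f hz)
  · rintro ⟨z, rfl⟩
    induction z using BTensor.induction with
    | tmul x y =>
      have hx : f.toAddMonoidHom (i.toAddMonoidHom x) = 0 := DFunLike.congr_fun h.2.2.2.1 x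
      rw [BTensor.mapLeft_tmul, BTensor.mapLeft_tmul, hx, BTensor.zero_tmul]
    | add z w hz hw => rw [map_add, map_add, hz, hw, add_zero]

theorem FlatNonunitalRight.tFlatRight (hR : TUnitalRing R) {F : Type v} [AddCommGroup F]
    [NonunitalModule Rᵐᵒᵖ F] (hF : TUnitalRight R F) (hflat : FlatNonunitalRight R F) :
    TFlatRight R F := by
  intro K L M _ _ _ _ _ _ i f h
  refine ⟨(injective_iff_map_eq_zero _).2 fun z hz => ?_, fun z => ⟨fun hz => ?_, ?_⟩⟩
  · have hle : AddSubgroup.closure {t : BTensor R F K | ∃ y x, i.toAddMonoidHom x = 0 ∧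
        t = BTensor.tmul R y x} ≤ ⊥ := (AddSubgroup.closure_le _).2 <| by
      rintro _ ⟨y, x, hx, rfl⟩
      change BTensor.tmul R y x = 0
      induction y using hF.induction with
      | smul r y => rw [BTensor.smul_tmul, h.smul_eq_zero hR x hx, BTensor.tmul_zero]
      | add y y' hy hy' => rw [BTensor.add_tmul, hy, hy', add_zero]
    exact hle (hflat.mem_closure_of_mapRight_eq_zero i hz)
  · have hle : AddSubgroup.closure {t : BTensor R F L | ∃ y x, f.toAddMonoidHom x = 0 ∧
        t = BTensor.tmul R y x} ≤
          (BTensor.mapRight (R := R) F i.toAddMonoidHom i.map_smul).range :=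
      (AddSubgroup.closure_le _).2 <| by
      rintro _ ⟨y, x, hx, rfl⟩
      rw [SetLike.mem_coe]
      induction y using hF.induction with
      | smul r y =>
        obtain ⟨k, hk⟩ := h.exists_eq_smul hR x hx r
        exact ⟨BTensor.tmul R y k, by rw [BTensor.mapRight_tmul, hk, BTensor.smul_tmul]⟩
      | add y y' hy hy' => rw [BTensor.add_tmul]; exact add_mem hy hy'
    exact hle (hflat.mem_closure_of_mapRight_eq_zero f hz)
  · rintro ⟨z, rfl⟩
    induction z using BTensor.induction with
    | tmul y x =>
      have hx : f.toAddMonoidHom (i.toAddMonoidHom x) = 0 := DFunLike.congr_fun h.2.2.2.1 x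
      rw [BTensor.mapRight_tmul, BTensor.mapRight_tmul, hx, BTensor.tmul_zero]
    | add z w hz hw => rw [map_add, map_add, hz, hw, add_zero]

/-- Tensoring an injective homomorphism of right modules with `R` gives a monomorphism of
t-unital modules. -/
theorem isKernelIn_zero_rTensor (hR : TUnitalRing R) {N N' : Type (max u v)} [AddCommGroup N]
    [NonunitalModule Rᵐᵒᵖ N] [AddCommGroup N'] [NonunitalModule Rᵐᵒᵖ N'] (f : Hom Rᵐᵒᵖ N N')
    (hf : Function.Injective f.toAddMonoidHom) :
    IsKernelIn (fun X _ _ => TUnitalRight R X)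
      (Hom.zero Rᵐᵒᵖ PUnit.{max u v + 1} (BTensor R N R)) f.rTensor := by
  refine ⟨tUnitalRight_punit, hR.tUnitalRight_tensor N, hR.tUnitalRight_tensor N',
    AddMonoidHom.ext fun _ => map_zero f.rTensor.toAddMonoidHom, fun X _ _ hX g hg => ?_⟩
  refine ⟨Hom.zero Rᵐᵒᵖ X PUnit, ?_, fun h _ => ?_⟩
  · refine AddMonoidHom.ext fun x => ?_
    change 0 = g.toAddMonoidHom x
    induction x using hX.induction with
    | smul r x =>
      have hcomm : ∀ z, f.toAddMonoidHom (rightUnitMap R N z) =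
          rightUnitMap R N' (f.rTensor.toAddMonoidHom z) := fun z => by
        induction z using BTensor.induction with
        | tmul x s => exact f.map_smul (op s) x
        | add z w hz hw => simp only [map_add, hz, hw]
      -- Hence `R` kills the kernel of `N ⊗_R R → N`. Since `f` is injective, `g x` lies in that
      -- kernel, so `g (x r) = (g x) r = 0`; such products generate the t-unital module `X`.
      have hsmul : ∀ z : BTensor R N R, op r • z = BTensor.tmul R (rightUnitMap R N z) r :=
        fun z => by
        induction z using BTensor.induction with
        | tmul x s => exact (BTensor.smul_tmul x s r).symm
        | add z w hz hw => rw [NonunitalModule.smul_add, hz, hw, map_add, BTensor.add_tmul]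
      have hgx : f.rTensor.toAddMonoidHom (g.toAddMonoidHom x) = 0 := DFunLike.congr_fun hg x
      have hzero : rightUnitMap R N (g.toAddMonoidHom x) = 0 := by
        apply hf
        rw [hcomm, hgx, map_zero, map_zero]
      rw [g.map_smul, hsmul, hzero, BTensor.zero_tmul]
    | add x y hx hy => rw [map_add, ← hx, ← hy, add_zero]
  · exact Hom.ext_toAddMonoidHom (AddMonoidHom.ext fun _ => rfl)

/-- Tensoring an injective homomorphism of left modules with `R` gives a monomorphism of
t-unital modules. -/
theorem isKernelIn_zero_lTensor (hR : TUnitalRing R) {N N' : Type (max u v)} [AddCommGroup N]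
    [NonunitalModule R N] [AddCommGroup N'] [NonunitalModule R N'] (f : Hom R N N')
    (hf : Function.Injective f.toAddMonoidHom) :
    IsKernelIn (fun X _ _ => TUnitalLeft R X)
      (Hom.zero R PUnit.{max u v + 1} (BTensor R R N)) f.lTensor := by
  refine ⟨tUnitalLeft_punit, hR.tUnitalLeft_tensor N, hR.tUnitalLeft_tensor N',
    AddMonoidHom.ext fun _ => map_zero f.lTensor.toAddMonoidHom, fun X _ _ hX g hg => ?_⟩
  refine ⟨Hom.zero R X PUnit, ?_, fun h _ => ?_⟩
  · refine AddMonoidHom.ext fun x => ?_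
    change 0 = g.toAddMonoidHom x
    induction x using hX.induction with
    | smul r x =>
      have hcomm : ∀ z, f.toAddMonoidHom (leftUnitMap R N z) =
          leftUnitMap R N' (f.lTensor.toAddMonoidHom z) := fun z => by
        induction z using BTensor.induction with
        | tmul s x => exact f.map_smul s x
        | add z w hz hw => simp only [map_add, hz, hw]
      have hsmul : ∀ z : BTensor R R N, r • z = BTensor.tmul R r (leftUnitMap R N z) :=
        fun z => by
        induction z using BTensor.induction with
        | tmul s x => exact BTensor.smul_tmul r s x
        | add z w hz hw => rw [NonunitalModule.smul_add, hz, hw, map_add, BTensor.tmul_add]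
      have hgx : f.lTensor.toAddMonoidHom (g.toAddMonoidHom x) = 0 := DFunLike.congr_fun hg x
      have hzero : leftUnitMap R N (g.toAddMonoidHom x) = 0 := by
        apply hf
        rw [hcomm, hgx, map_zero, map_zero]
      rw [g.map_smul, hsmul, hzero, BTensor.tmul_zero]
    | add x y hx hy => rw [map_add, ← hx, ← hy, add_zero]
  · exact Hom.ext_toAddMonoidHom (AddMonoidHom.ext fun _ => rfl)

/-- Naturality of the absorption isomorphism transports injectivity from `(f ⊗ R) ⊗ F` to `f ⊗ F`.
-/
theorem TFlatLeft.flatNonunitalLeft (hR : TUnitalRing R) {F : Type v} [AddCommGroup F]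
    [NonunitalModule R F] (hF : TUnitalLeft R F) (hflat : TFlatLeft R F) :
    FlatNonunitalLeft R F := by
  refine (flatNonunitalLeft_iff F).2 fun N N' _ _ _ _ f hf => ?_
  refine (injective_iff_map_eq_zero _).2 fun z hz => ?_
  obtain ⟨-, hex⟩ := hflat _ _ _ _ _ (isKernelIn_zero_rTensor.{u, v} hR f hf)
  obtain ⟨z, rfl⟩ := (hF.bijective_mapLeft_rightUnitHom N).2 z
  have hcomm : (BTensor.mapLeft (R := R) F f.toAddMonoidHom f.map_smul).comp
      (BTensor.mapLeft (R := R) F (rightUnitHom (R := R) N).toAddMonoidHom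
        (rightUnitHom (R := R) N).map_smul) =
      (BTensor.mapLeft (R := R) F (rightUnitHom (R := R) N').toAddMonoidHom
        (rightUnitHom (R := R) N').map_smul).comp
      (BTensor.mapLeft (R := R) F f.rTensor.toAddMonoidHom f.rTensor.map_smul) := by
    refine BTensor.hom_ext fun w y => ?_
    induction w using BTensor.induction with
    | tmul x r => exact congrArg (BTensor.tmul R · y) (f.map_smul (op r) x)
    | add z w hz hw => rw [BTensor.add_tmul, map_add, map_add, hz, hw]
  have hz' : BTensor.mapLeft (R := R) F f.rTensor.toAddMonoidHom f.rTensor.map_smul z = 0 := by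
    apply (hF.bijective_mapLeft_rightUnitHom N').1
    rw [map_zero]
    exact (DFunLike.congr_fun hcomm z).symm.trans hz
  -- Exactness puts `z` in the image of a map induced by the zero homomorphism, so `z = 0`.
  obtain ⟨w, rfl⟩ := (hex z).1 hz'
  have hw : BTensor.mapLeft (R := R) F (Hom.zero Rᵐᵒᵖ PUnit (BTensor R N R)).toAddMonoidHom
      (Hom.zero Rᵐᵒᵖ PUnit (BTensor R N R)).map_smul = 0 :=
    BTensor.hom_ext fun _ y => BTensor.zero_tmul y
  rw [hw, AddMonoidHom.zero_apply, map_zero]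

theorem TFlatRight.flatNonunitalRight (hR : TUnitalRing R) {F : Type v} [AddCommGroup F]
    [NonunitalModule Rᵐᵒᵖ F] (hF : TUnitalRight R F) (hflat : TFlatRight R F) :
    FlatNonunitalRight R F := by
  refine (flatNonunitalRight_iff F).2 fun N N' _ _ _ _ f hf => ?_
  refine (injective_iff_map_eq_zero _).2 fun z hz => ?_
  obtain ⟨-, hex⟩ := hflat _ _ _ _ _ (isKernelIn_zero_lTensor.{u, v} hR f hf)
  obtain ⟨z, rfl⟩ := (hF.bijective_mapRight_leftUnitHom N).2 z
  have hcomm : (BTensor.mapRight (R := R) F f.toAddMonoidHom f.map_smul).comp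
      (BTensor.mapRight (R := R) F (leftUnitHom (R := R) N).toAddMonoidHom
        (leftUnitHom (R := R) N).map_smul) =
      (BTensor.mapRight (R := R) F (leftUnitHom (R := R) N').toAddMonoidHom
        (leftUnitHom (R := R) N').map_smul).comp
      (BTensor.mapRight (R := R) F f.lTensor.toAddMonoidHom f.lTensor.map_smul) := by
    refine BTensor.hom_ext fun y w => ?_
    induction w using BTensor.induction with
    | tmul r x => exact congrArg (BTensor.tmul R y) (f.map_smul r x)
    | add z w hz hw => rw [BTensor.tmul_add, map_add, map_add, hz, hw]
  have hz' : BTensor.mapRight (R := R) F f.lTensor.toAddMonoidHom f.lTensor.map_smul z = 0 := by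
    apply (hF.bijective_mapRight_leftUnitHom N').1
    rw [map_zero]
    exact (DFunLike.congr_fun hcomm z).symm.trans hz
  -- Here too the kernel map is zero, so exactness amounts to injectivity of `F ⊗ (R ⊗ f)`.
  obtain ⟨w, rfl⟩ := (hex z).1 hz'
  have hw : BTensor.mapRight (R := R) F (Hom.zero R PUnit (BTensor R R N)).toAddMonoidHom
      (Hom.zero R PUnit (BTensor R R N)).map_smul = 0 :=
    BTensor.hom_ext fun y _ => BTensor.tmul_zero y
  rw [hw, AddMonoidHom.zero_apply, map_zero]

end Flatness

end NonunitalTensor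

theorem corollary8p17 {R : Type u} [NonUnitalRing R] (hR : NonunitalTensor.TUnitalRing R) :
    (∀ (F : Type v) [AddCommGroup F] [NonunitalTensor.NonunitalModule R F],
      NonunitalTensor.TUnitalLeft R F →
        (NonunitalTensor.TFlatLeft R F ↔ NonunitalTensor.FlatNonunitalLeft R F)) ∧
    (∀ (F : Type v) [AddCommGroup F] [NonunitalTensor.NonunitalModule Rᵐᵒᵖ F],
      NonunitalTensor.TUnitalRight R F →
        (NonunitalTensor.TFlatRight R F ↔ NonunitalTensor.FlatNonunitalRight R F)) :=
  ⟨fun _ _ _ hF => ⟨fun h => h.flatNonunitalLeft hR hF, fun h => h.tFlatLeft hR hF⟩,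
    fun _ _ _ hF => ⟨fun h => h.flatNonunitalRight hR hF, fun h => h.tFlatRight hR hF⟩⟩
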